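/- For integers $n\ge 2$ and $1\le k\le n-1$ let $Q_{n,k}$ be the enhanced hypercube: the simple graph whose vertices are the binary words $x_1x_2\cdots x_n$, two words being adjacent if one is obtained from the other by complementing exactly one bit $x_i$ ($1\le i\le n$), or by complementing all of the bits $x_k,x_{k+1},\dots,x_n$. For a finite connected graph $\Gamma$ let $Kf(\Gamma)=\sum_{\{u,v\}} r_{uv}$ be its Kirchhoff index, where the sum is over unordered pairs of vertices and $r_{uv}$ is the resistance distance, i.e. the effective resistance between $u$ and $v$ when every edge of $\Gamma$ is a unit resistor. Then $$\lim_{n\to\infty}\frac{Kf(Q_{n,k})}{2^{2n}/(n+1)}=1$$ uniformly in $k$: for every $\varepsilon>0$ there is an $N$ such that for all $n\ge N$ and all $k$ with $1\le k\le n-1$, $$\left|\frac{Kf(Q_{n,k})}{2^{2n}/(n+1)}-1\right|<\varepsilon .$$ -/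

import Mathlib

namespace EnhancedHypercube

section Resistance

variable {V : Type*} [Fintype V]

open Classical in
/-- Every edge of `G` is a unit resistor, a unit current enters the network at `u` and leaves it
at `v`, and `φ` is the electric potential: by Ohm's law the current from `x` to a neighbour `y`
is `φ x - φ y`, and by Kirchhoff's current law the net current out of each node `x` is the
current supplied there from outside. -/
def IsUnitCurrentPotential (G : SimpleGraph V) (u v : V) (φ : V → ℝ) : Prop :=
  ∀ x : V, (∑ y : V, if G.Adj x y then φ x - φ y else 0) =
    (if x = u then 1 else 0) - (if x = v then 1 else 0)

open Classical in
/-- The resistance distance between `u` and `v`: the potential difference between `u` and `v`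
when a unit current flows from `u` to `v`. In a connected graph such a potential exists and the
difference does not depend on its choice (both facts are proved below); the value `0` in the
other branch is never used for a connected graph. -/
noncomputable def resistanceDist (G : SimpleGraph V) (u v : V) : ℝ :=
  if h : ∃ φ : V → ℝ, IsUnitCurrentPotential G u v φ then h.choose u - h.choose v else 0

/-- The Kirchhoff index: the sum of the resistance distances over unordered pairs of vertices,
written as half of the sum over ordered pairs (the diagonal terms are zero). -/
noncomputable def kirchhoffIndex (G : SimpleGraph V) : ℝ :=
  (∑ u : V, ∑ v : V, resistanceDist G u v) / 2

theorem resistanceDist_self (G : SimpleGraph V) (u : V) : resistanceDist G u u = 0 := by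
  unfold resistanceDist
  split_ifs <;> simp

open Classical in
theorem lapMatrix_mulVec_eq_sum (G : SimpleGraph V) (φ : V → ℝ) (x : V) :
    (G.lapMatrix ℝ).mulVec φ x = ∑ y : V, if G.Adj x y then φ x - φ y else 0 := by
  rw [SimpleGraph.lapMatrix_mulVec_apply, ← Finset.sum_filter, Finset.sum_sub_distrib,
    Finset.sum_const, nsmul_eq_mul, ← SimpleGraph.neighborFinset_eq_filter,
    SimpleGraph.card_neighborFinset_eq_degree]

/-- The potential difference does not depend on the chosen potential. -/
theorem resistanceDist_eq {G : SimpleGraph V} (hG : G.Connected) {u v : V} {φ : V → ℝ}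
    (hφ : IsUnitCurrentPotential G u v φ) : resistanceDist G u v = φ u - φ v := by
  classical
  have h : ∃ φ : V → ℝ, IsUnitCurrentPotential G u v φ := ⟨φ, hφ⟩
  have hc := h.choose_spec
  unfold resistanceDist
  rw [dif_pos h]
  set ψ := h.choose
  have key : (G.lapMatrix ℝ).mulVec (ψ - φ) = 0 := by
    funext x
    rw [Matrix.mulVec_sub, Pi.sub_apply, lapMatrix_mulVec_eq_sum, lapMatrix_mulVec_eq_sum,
      hc x, hφ x, sub_self, Pi.zero_apply]
  have := (SimpleGraph.lapMatrix_mulVec_eq_zero_iff_forall_reachable (G := G)).1 key u v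
    (hG.preconnected u v)
  simp only [Pi.sub_apply] at this
  linarith

/-- In a connected graph the potential exists. -/
theorem exists_isUnitCurrentPotential {G : SimpleGraph V} (hG : G.Connected) (u v : V) :
    ∃ φ : V → ℝ, IsUnitCurrentPotential G u v φ := by
  classical
  set L := Matrix.toLin' (G.lapMatrix ℝ) with hL
  let s : (V → ℝ) →ₗ[ℝ] ℝ := ∑ x : V, LinearMap.proj x
  have hs : ∀ f, s f = ∑ x, f x := fun f => by simp [s]
  have hle : LinearMap.range L ≤ LinearMap.ker s := by
    rintro _ ⟨φ, rfl⟩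
    rw [LinearMap.mem_ker, hs]
    simp only [hL, Matrix.toLin'_apply]
    simp only [lapMatrix_mulVec_eq_sum]
    have h1 : (∑ x, ∑ y, if G.Adj x y then φ x - φ y else 0) =
        -∑ x, ∑ y, if G.Adj x y then φ x - φ y else 0 := by
      conv_lhs => rw [Finset.sum_comm]
      rw [← Finset.sum_neg_distrib]
      refine Finset.sum_congr rfl fun x _ => ?_
      rw [← Finset.sum_neg_distrib]
      refine Finset.sum_congr rfl fun y _ => ?_
      simp only [G.adj_comm y x]
      split_ifs <;> ring
    linarith
  have hk : Module.finrank ℝ (LinearMap.ker L) = 1 := by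
    have := SimpleGraph.card_connectedComponent_eq_finrank_ker_toLin'_lapMatrix G
    rw [← this]
    have := hG.preconnected.subsingleton_connectedComponent
    have := hG.nonempty
    have : Nonempty G.ConnectedComponent := ⟨G.connectedComponentMk u⟩
    exact Fintype.card_eq_one_iff_nonempty_unique.2 ⟨⟨⟨G.connectedComponentMk u⟩,
      fun _ => Subsingleton.elim _ _⟩⟩
  have hs1 : Module.finrank ℝ (LinearMap.range s) = 1 := by
    have : LinearMap.range s = ⊤ := by
      rw [LinearMap.range_eq_top]
      intro c
      exact ⟨Pi.single u c, by rw [hs]; simp⟩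
    rw [this, finrank_top, Module.finrank_self]
  have e1 := LinearMap.finrank_range_add_finrank_ker L
  have e2 := LinearMap.finrank_range_add_finrank_ker s
  have heq := Submodule.eq_of_le_of_finrank_eq hle (by omega)
  have hm : (Pi.single u 1 - Pi.single v 1 : V → ℝ) ∈ LinearMap.range L := by
    rw [heq, LinearMap.mem_ker, hs]
    simp
  obtain ⟨φ, hφ⟩ := hm
  refine ⟨φ, fun x => ?_⟩
  have := congrFun hφ x
  rw [hL, Matrix.toLin'_apply, lapMatrix_mulVec_eq_sum] at this
  rw [this]
  simp [Pi.single_apply]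

end Resistance

/-- The vector `ε_k ∈ (ℤ/2)ⁿ` whose first `k - 1` entries are `0` and whose other entries are `1`;
the coordinate `x_i`, `1 ≤ i ≤ n`, has the index `i - 1 : Fin n`. -/
def tailVec (n k : ℕ) : Fin n → ZMod 2 := fun j => if k ≤ (j : ℕ) + 1 then 1 else 0

/-- The enhanced hypercube `Q_{n,k}` on the binary words of length `n`: the neighbours of `X` are
obtained by complementing one bit, or by complementing all the bits `x_k, …, x_n`
(complementing a bit is adding `1` modulo `2`). The condition `X ≠ Y` only matters outside the
range `1 ≤ k ≤ n`. -/
def enhancedHypercube (n k : ℕ) : SimpleGraph (Fin n → ZMod 2) where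
  Adj X Y := X ≠ Y ∧ ((∃ i : Fin n, Y = X + Pi.single i 1) ∨ Y = X + tailVec n k)
  symm := ⟨by
    have h2 : ∀ a b : Fin n → ZMod 2, a + b + b = a := fun a b => by
      funext i
      simp only [Pi.add_apply]
      rw [add_assoc, CharTwo.add_self_eq_zero, add_zero]
    rintro X Y ⟨hne, ⟨i, rfl⟩ | rfl⟩
    · exact ⟨hne.symm, Or.inl ⟨i, (h2 _ _).symm⟩⟩
    · exact ⟨hne.symm, Or.inr (h2 _ _).symm⟩⟩
  loopless := ⟨fun _ h => h.1 rfl⟩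

/-- The enhanced hypercube is connected, so its resistance distances are meaningful. -/
theorem enhancedHypercube_connected (n k : ℕ) : (enhancedHypercube n k).Connected := by
  have hadd : ∀ (i : Fin n) (c : ZMod 2) (X : Fin n → ZMod 2),
      (enhancedHypercube n k).Reachable X (X + Pi.single i c) := by
    intro i c X
    have hc : c = 0 ∨ c = 1 := by revert c; decide
    rcases hc with rfl | rfl
    · simp
    · refine SimpleGraph.Adj.reachable ⟨fun h => ?_, Or.inl ⟨i, rfl⟩⟩
      simpa using congrFun h i
  have hsum : ∀ (X : Fin n → ZMod 2) (s : Finset (Fin n)),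
      (enhancedHypercube n k).Reachable 0 (∑ i ∈ s, Pi.single i (X i)) := by
    intro X s
    induction s using Finset.induction_on with
    | empty => simp
    | insert i s hi ih =>
      rw [Finset.sum_insert hi, add_comm]
      exact ih.trans (hadd _ _ _)
  have h0 : ∀ X : Fin n → ZMod 2, (enhancedHypercube n k).Reachable 0 X := fun X => by
    have := hsum X Finset.univ
    rwa [Finset.univ_sum_single] at this
  exact { preconnected := fun X Y => (h0 X).symm.trans (h0 Y), nonempty := ⟨0⟩ }

end EnhancedHypercube

namespace EnhancedHypercube

open Finset

/-! The graph is a Cayley graph of `(ℤ/2)ⁿ`, so the Walsh characters diagonalise its Laplacian. The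
eigenvalue at `S` is `2|S|`, plus `2` when the character is `-1` at `tailVec n k`. Expanding
potentials in characters gives `Kf = 2^n ∑ 1/λ_S` over `S ≠ ∅` (`kirchhoffIndex_enhancedHypercube`).

Whatever `k` is, `2|S| ≤ λ_S ≤ 2|S| + 2`; this makes the limit uniform. Both bounds reduce to `∑
1/(2(|S|+1))`, which is `2^n/(n+1)` up to lower order, and replacing `1/(2|S|)` by `1/(2(|S|+1))`
costs only a relative error `O(1/n)`. -/

/-! ### Walsh characters -/

/-- The real sign of an element of `ℤ/2`. -/
def bitSign (a : ZMod 2) : ℝ := if a = 0 then 1 else -1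

theorem bitSign_add : ∀ a b : ZMod 2, bitSign (a + b) = bitSign a * bitSign b := by
  intro a b
  have ha : a = 0 ∨ a = 1 := by revert a; decide
  have hb : b = 0 ∨ b = 1 := by revert b; decide
  have h11 : (1 : ZMod 2) + 1 = 0 := by decide
  rcases ha with rfl | rfl <;> rcases hb with rfl | rfl <;> simp [bitSign, h11]

/-- The Walsh character of `(ℤ/2)ⁿ` indexed by `S`. -/
def walsh {n : ℕ} (S : Finset (Fin n)) (x : Fin n → ZMod 2) : ℝ := ∏ i ∈ S, bitSign (x i)

theorem walsh_add {n : ℕ} (S : Finset (Fin n)) (x y : Fin n → ZMod 2) :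
    walsh S (x + y) = walsh S x * walsh S y := by
  simp [walsh, bitSign_add, prod_mul_distrib]

theorem walsh_zero {n : ℕ} (S : Finset (Fin n)) : walsh S 0 = 1 := by
  simp [walsh, bitSign]

theorem walsh_single {n : ℕ} (S : Finset (Fin n)) (i : Fin n) :
    walsh S (Pi.single i 1) = if i ∈ S then -1 else 1 := by
  have : ∀ j, bitSign ((Pi.single i 1 : Fin n → ZMod 2) j) = if j = i then -1 else 1 := by
    intro j
    by_cases h : j = i
    · subst h; simp [bitSign]
    · simp [bitSign, h]
  simp [walsh, this]

theorem walsh_eq_one_or {n : ℕ} (S : Finset (Fin n)) (x : Fin n → ZMod 2) :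
    walsh S x = 1 ∨ walsh S x = -1 := by
  have h2 : x + x = 0 := funext fun i => CharTwo.add_self_eq_zero (x i)
  have h := walsh_add S x x
  rw [h2, walsh_zero] at h
  exact mul_self_eq_one_iff.1 h.symm

theorem sum_walsh_index {n : ℕ} (x : Fin n → ZMod 2) :
    ∑ S : Finset (Fin n), walsh S x = if x = 0 then 2 ^ n else 0 := by
  have h : ∑ S : Finset (Fin n), walsh S x = ∏ i, (1 + bitSign (x i)) := by
    rw [prod_one_add, powerset_univ]
    rfl
  rw [h]
  split_ifs with hx
  · subst hx
    simp only [bitSign, Pi.zero_apply, if_true]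
    norm_num
  · obtain ⟨i, hi⟩ := Function.ne_iff.1 hx
    exact prod_eq_zero (mem_univ i) (by simp [bitSign, show x i ≠ 0 from hi])

/-- Translation by a basis vector with index in `S` permutes the words and reverses the sign of the
character. -/
theorem sum_walsh_eq_zero {n : ℕ} {S : Finset (Fin n)} (hS : S ≠ ∅) :
    ∑ x : Fin n → ZMod 2, walsh S x = 0 := by
  obtain ⟨i, hi⟩ := nonempty_iff_ne_empty.2 hS
  have h := Equiv.sum_comp (Equiv.addRight (Pi.single i (1 : ZMod 2))) (walsh S)
  simp only [Equiv.coe_addRight, walsh_add, walsh_single, if_pos hi, ← sum_mul] at h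
  linarith

/-! ### Spectrum of the Laplacian -/

/-- The eigenvalue of the Laplacian of the enhanced hypercube on the Walsh character of `S`. -/
def laplaceEigenvalue {n : ℕ} (k : ℕ) (S : Finset (Fin n)) : ℝ :=
  2 * (#S : ℝ) + (1 - walsh S (tailVec n k))

theorem le_laplaceEigenvalue {n : ℕ} (k : ℕ) (S : Finset (Fin n)) :
    2 * (#S : ℝ) ≤ laplaceEigenvalue k S := by
  unfold laplaceEigenvalue
  rcases walsh_eq_one_or S (tailVec n k) with h | h <;> rw [h] <;> linarith

theorem laplaceEigenvalue_le {n : ℕ} (k : ℕ) (S : Finset (Fin n)) :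
    laplaceEigenvalue k S ≤ 2 * ((#S : ℝ) + 1) := by
  unfold laplaceEigenvalue
  rcases walsh_eq_one_or S (tailVec n k) with h | h <;> rw [h] <;> linarith

theorem laplaceEigenvalue_pos {n : ℕ} (k : ℕ) {S : Finset (Fin n)} (hS : S ≠ ∅) :
    0 < laplaceEigenvalue k S := by
  have h : (0 : ℝ) < #S := by exact_mod_cast card_pos.2 (nonempty_iff_ne_empty.2 hS)
  linarith [le_laplaceEigenvalue k S]

/-- As `k ≤ n - 1`, the tail contains the last two positions. Hence the `n + 1` generators are
distinct and no edge is counted twice. -/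
theorem tailVec_ne_single {n k : ℕ} (hk : 1 ≤ k) (hkn : k + 1 ≤ n) (i : Fin n) :
    tailVec n k ≠ Pi.single i 1 := by
  intro h
  have key : ∀ j : Fin n, k ≤ (j : ℕ) + 1 → j = i := by
    intro j hj
    by_contra hne
    have := congrFun h j
    simp [tailVec, hj, hne] at this
  have h1 := key ⟨n - 1, by omega⟩ (by simp only; omega)
  have h2 := key ⟨n - 2, by omega⟩ (by simp only; omega)
  have h12 : n - 1 = n - 2 := Fin.mk.inj_iff.1 (h1.trans h2.symm)
  omega

theorem tailVec_ne_zero {n k : ℕ} (hkn : k + 1 ≤ n) : tailVec n k ≠ 0 := by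
  intro h
  have := congrFun h ⟨n - 1, by omega⟩
  simp [tailVec, show k ≤ n - 1 + 1 by omega] at this

open Classical in
/-- The Laplacian of the enhanced hypercube as a sum over its generators. -/
theorem sum_adj_sub_eq {n k : ℕ} (hk : 1 ≤ k) (hkn : k + 1 ≤ n) (f : (Fin n → ZMod 2) → ℝ)
    (x : Fin n → ZMod 2) :
    (∑ y, if (enhancedHypercube n k).Adj x y then f x - f y else 0) =
      ∑ i, (f x - f (x + Pi.single i 1)) + (f x - f (x + tailVec n k)) := by
  have hset : univ.filter (fun y => (enhancedHypercube n k).Adj x y) =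
      insert (x + tailVec n k) (univ.image fun i => x + Pi.single i 1) := by
    ext y
    rw [mem_filter_univ, mem_insert, mem_image]
    simp only [mem_univ, true_and]
    constructor
    · rintro ⟨-, ⟨i, rfl⟩ | rfl⟩
      · exact Or.inr ⟨i, rfl⟩
      · exact Or.inl rfl
    · rintro (rfl | ⟨i, rfl⟩)
      · exact ⟨fun h => tailVec_ne_zero hkn (left_eq_add.1 h), Or.inr rfl⟩
      · refine ⟨fun h => ?_, Or.inl ⟨i, rfl⟩⟩
        simpa using congrFun (left_eq_add.1 h) i
  rw [← sum_filter, hset, sum_insert, sum_image, add_comm]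
  · intro i _ j _ hij
    by_contra hne
    have := congrFun (add_left_cancel hij) i
    simp [hne] at this
  · simp only [mem_image, mem_univ, true_and, not_exists]
    exact fun i h => tailVec_ne_single hk hkn i (add_left_cancel h).symm

theorem laplaceEigenvalue_mul_walsh {n : ℕ} (k : ℕ) (S : Finset (Fin n)) (x : Fin n → ZMod 2) :
    ∑ i, (walsh S x - walsh S (x + Pi.single i 1)) + (walsh S x - walsh S (x + tailVec n k)) =
      laplaceEigenvalue k S * walsh S x := by
  have h : ∀ i, walsh S x - walsh S (x + Pi.single i 1) =
      if i ∈ S then 2 * walsh S x else 0 := by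
    intro i
    rw [walsh_add, walsh_single]
    split_ifs <;> ring
  simp only [h, sum_ite_mem, univ_inter, sum_const, nsmul_eq_mul]
  rw [walsh_add, laplaceEigenvalue]
  ring

/-- Fourier expansion of a point mass. The decidability instance is left free so that the rewrite
matches the one in `IsUnitCurrentPotential`. -/
theorem ite_eq_sum_walsh {n : ℕ} (x w : Fin n → ZMod 2) {_ : Decidable (x = w)} :
    (if x = w then (1 : ℝ) else 0) =
      (∑ S : Finset (Fin n), walsh S w * walsh S x) / 2 ^ n := by
  simp only [← walsh_add, sum_walsh_index]
  have : w + x = 0 ↔ x = w := by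
    simp only [funext_iff, Pi.add_apply, Pi.zero_apply, CharTwo.add_eq_zero, eq_comm]
  simp only [this]
  split_ifs <;> simp

/-! ### Potentials and the Kirchhoff index -/

/-- The potential of a unit current from `u` to `v`, expanded in Walsh characters. -/
noncomputable def walshPotential (n k : ℕ) (u v x : Fin n → ZMod 2) : ℝ :=
  ∑ S ∈ univ.erase (∅ : Finset (Fin n)),
    (walsh S u - walsh S v) / (2 ^ n * laplaceEigenvalue k S) * walsh S x

theorem isUnitCurrentPotential_walshPotential {n k : ℕ} (hk : 1 ≤ k) (hkn : k + 1 ≤ n)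
    (u v : Fin n → ZMod 2) :
    IsUnitCurrentPotential (enhancedHypercube n k) u v (walshPotential n k u v) := by
  intro x
  rw [sum_adj_sub_eq hk hkn]
  have hsum : ∑ i, (walshPotential n k u v x - walshPotential n k u v (x + Pi.single i 1)) +
      (walshPotential n k u v x - walshPotential n k u v (x + tailVec n k)) =
      ∑ S ∈ univ.erase (∅ : Finset (Fin n)),
        (walsh S u - walsh S v) / (2 ^ n * laplaceEigenvalue k S) *
          (laplaceEigenvalue k S * walsh S x) := by
    simp only [← laplaceEigenvalue_mul_walsh, walshPotential, ← sum_sub_distrib]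
    rw [sum_comm, ← sum_add_distrib]
    refine sum_congr rfl fun S _ => ?_
    rw [mul_add, mul_sum]
    simp only [mul_sub]
  -- The two point masses have the same coefficient at `∅`, so the zero eigenvalue is never
  -- inverted.
  rw [hsum, ite_eq_sum_walsh x u, ite_eq_sum_walsh x v, ← sub_div, ← sum_sub_distrib, sum_div,
    ← add_sum_erase _ _ (mem_univ ∅)]
  simp only [walsh, prod_empty, mul_one, sub_self, zero_div, zero_add]
  refine sum_congr rfl fun S hS => ?_
  have h0 := (laplaceEigenvalue_pos k (ne_of_mem_erase hS)).ne'
  field_simp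

theorem kirchhoffIndex_enhancedHypercube {n k : ℕ} (hk : 1 ≤ k) (hkn : k + 1 ≤ n) :
    kirchhoffIndex (enhancedHypercube n k) =
      2 ^ n * ∑ S ∈ univ.erase (∅ : Finset (Fin n)), (laplaceEigenvalue k S)⁻¹ := by
  have hr : ∀ u v, resistanceDist (enhancedHypercube n k) u v =
      ∑ S ∈ univ.erase (∅ : Finset (Fin n)),
        (2 - 2 * (walsh S u * walsh S v)) / (2 ^ n * laplaceEigenvalue k S) := by
    intro u v
    rw [resistanceDist_eq (enhancedHypercube_connected n k)
      (isUnitCurrentPotential_walshPotential hk hkn u v), walshPotential, walshPotential,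
      ← sum_sub_distrib]
    refine sum_congr rfl fun S _ => ?_
    have hu : walsh S u * walsh S u = 1 := by
      rcases walsh_eq_one_or S u with h | h <;> rw [h] <;> norm_num
    have hv : walsh S v * walsh S v = 1 := by
      rcases walsh_eq_one_or S v with h | h <;> rw [h] <;> norm_num
    rw [← mul_sub, div_mul_eq_mul_div]
    congr 1
    linear_combination hu + hv
  -- The product of characters sums to zero over `u` and `v`; only the constant `2` survives, over
  -- `4^n` pairs.
  have hS : ∀ S ∈ univ.erase (∅ : Finset (Fin n)),
      ∑ u : Fin n → ZMod 2, ∑ v : Fin n → ZMod 2,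
        (2 - 2 * (walsh S u * walsh S v)) / (2 ^ n * laplaceEigenvalue k S) =
      2 * (2 ^ n * (laplaceEigenvalue k S)⁻¹) := by
    intro S hS
    have h0 := (laplaceEigenvalue_pos k (ne_of_mem_erase hS)).ne'
    simp only [← sum_div, sum_sub_distrib, ← mul_sum, sum_walsh_eq_zero (ne_of_mem_erase hS)]
    simp
    field_simp
  simp only [kirchhoffIndex, hr]
  have hc : ∀ u : Fin n → ZMod 2, ∑ v : Fin n → ZMod 2, ∑ S ∈ univ.erase (∅ : Finset (Fin n)),
        (2 - 2 * (walsh S u * walsh S v)) / (2 ^ n * laplaceEigenvalue k S) =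
      ∑ S ∈ univ.erase (∅ : Finset (Fin n)), ∑ v : Fin n → ZMod 2,
        (2 - 2 * (walsh S u * walsh S v)) / (2 ^ n * laplaceEigenvalue k S) :=
    fun u => sum_comm
  simp only [hc]
  rw [sum_comm, sum_congr rfl hS, ← mul_sum, ← mul_sum]
  ring

/-! ### Binomial sums and bounds on the spectral sum -/

/-- Absorption, `(n+1) C(n,m) = (m+1) C(n+1,m+1)`, turns this into a full binomial row without its
first entry. -/
theorem sum_inv_card_add_one (n : ℕ) :
    ∑ S : Finset (Fin n), ((#S : ℝ) + 1)⁻¹ = (2 ^ (n + 1) - 1) / (n + 1) := by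
  have h := sum_powerset_apply_card (fun m : ℕ => ((m : ℝ) + 1)⁻¹) (x := (univ : Finset (Fin n)))
  rw [powerset_univ, card_univ, Fintype.card_fin] at h
  rw [h]
  have hs : ∑ m ∈ range (n + 2), ((n + 1).choose m : ℝ) = 2 ^ (n + 1) := by
    exact_mod_cast Nat.sum_range_choose (n + 1)
  rw [sum_range_succ'] at hs
  rw [eq_div_iff (by positivity), sum_mul]
  have ht : ∀ m ∈ range (n + 1), n.choose m • ((m : ℝ) + 1)⁻¹ * ((n : ℝ) + 1) =
      ((n + 1).choose (m + 1) : ℝ) := by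
    intro m _
    have : ((n : ℝ) + 1) * n.choose m = (n + 1).choose (m + 1) * ((m : ℝ) + 1) := by
      exact_mod_cast Nat.add_one_mul_choose_eq n m
    rw [nsmul_eq_mul]
    field_simp
    linarith
  rw [sum_congr rfl ht]
  simp at hs
  linarith

/-- Absorption used twice; dropping the first two entries of row `n + 2` gives the inequality. -/
theorem sum_inv_card_add_one_mul_card_add_two_le (n : ℕ) :
    ∑ S : Finset (Fin n), (((#S : ℝ) + 1) * ((#S : ℝ) + 2))⁻¹ ≤
      2 ^ (n + 2) / ((n + 1) * (n + 2)) := by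
  have h := sum_powerset_apply_card (fun m : ℕ => (((m : ℝ) + 1) * ((m : ℝ) + 2))⁻¹)
    (x := (univ : Finset (Fin n)))
  rw [powerset_univ, card_univ, Fintype.card_fin] at h
  rw [h]
  have hs : ∑ m ∈ range (n + 3), ((n + 2).choose m : ℝ) = 2 ^ (n + 2) := by
    exact_mod_cast Nat.sum_range_choose (n + 2)
  rw [sum_range_succ', sum_range_succ'] at hs
  rw [le_div_iff₀ (by positivity), sum_mul]
  have ht : ∀ m ∈ range (n + 1), n.choose m • (((m : ℝ) + 1) * ((m : ℝ) + 2))⁻¹ *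
      (((n : ℝ) + 1) * (n + 2)) = ((n + 2).choose (m + 1 + 1) : ℝ) := by
    intro m _
    have h1 : ((n : ℝ) + 1) * n.choose m = (n + 1).choose (m + 1) * ((m : ℝ) + 1) := by
      exact_mod_cast Nat.add_one_mul_choose_eq n m
    have h2 : ((n : ℝ) + 2) * (n + 1).choose (m + 1) =
        (n + 2).choose (m + 1 + 1) * ((m : ℝ) + 2) := by
      exact_mod_cast Nat.add_one_mul_choose_eq (n + 1) (m + 1)
    rw [nsmul_eq_mul]
    field_simp
    linear_combination ((n : ℝ) + 2) * h1 + ((m : ℝ) + 1) * h2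
  rw [sum_congr rfl ht]
  have h0 : (0 : ℝ) ≤ ((n + 2).choose (0 + 1) : ℝ) := by positivity
  have h1 : (0 : ℝ) ≤ ((n + 2).choose 0 : ℝ) := by positivity
  linarith

theorem le_sum_inv_laplaceEigenvalue (n k : ℕ) :
    ((2 ^ (n + 1) - 1) / ((n : ℝ) + 1) - 1) / 2 ≤
      ∑ S ∈ univ.erase (∅ : Finset (Fin n)), (laplaceEigenvalue k S)⁻¹ := by
  have h := sum_inv_card_add_one n
  rw [← add_sum_erase _ _ (mem_univ ∅)] at h
  simp only [card_empty, Nat.cast_zero, zero_add, inv_one] at h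
  rw [← h, add_sub_cancel_left, sum_div]
  refine sum_le_sum fun S hS => ?_
  have e : ((#S : ℝ) + 1)⁻¹ / 2 = (2 * ((#S : ℝ) + 1))⁻¹ := by
    rw [mul_inv]
    ring
  rw [e]
  exact inv_anti₀ (laplaceEigenvalue_pos k (ne_of_mem_erase hS)) (laplaceEigenvalue_le k S)

theorem sum_inv_laplaceEigenvalue_le (n k : ℕ) :
    ∑ S ∈ univ.erase (∅ : Finset (Fin n)), (laplaceEigenvalue k S)⁻¹ ≤
      2 ^ n / ((n : ℝ) + 1) + 6 * 2 ^ n / (((n : ℝ) + 1) * (n + 2)) := by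
  have hle : ∑ S ∈ univ.erase (∅ : Finset (Fin n)), (laplaceEigenvalue k S)⁻¹ ≤
      ∑ S ∈ univ.erase (∅ : Finset (Fin n)),
        (((#S : ℝ) + 1)⁻¹ / 2 + 3 / 2 * (((#S : ℝ) + 1) * ((#S : ℝ) + 2))⁻¹) := by
    refine sum_le_sum fun S hS => ?_
    have h1 : (1 : ℝ) ≤ #S := by
      exact_mod_cast card_pos.2 (nonempty_iff_ne_empty.2 (ne_of_mem_erase hS))
    refine (inv_anti₀ (by linarith) (le_laplaceEigenvalue k S)).trans ?_
    generalize (#S : ℝ) = m at h1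
    -- The difference `1/m - 1/(m+1)` is `1/(m(m+1))`, and `m + 2 ≤ 3m` for `m ≥ 1`, with equality
    -- at `m = 1`; hence the constant `3/2`.
    have : m⁻¹ / 2 ≤ (m + 1)⁻¹ / 2 + 3 / 2 * ((m + 1) * (m + 2))⁻¹ := by
      have e : (m + 1)⁻¹ / 2 + 3 / 2 * ((m + 1) * (m + 2))⁻¹ - m⁻¹ / 2 =
          (m - 1) / (m * (m + 1) * (m + 2)) := by
        field_simp
        ring
      have : 0 ≤ (m - 1) / (m * (m + 1) * (m + 2)) :=
        div_nonneg (by linarith) (by positivity)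
      linarith
    have e : (2 * m)⁻¹ = m⁻¹ / 2 := by
      rw [mul_inv]
      ring
    linarith
  have hle' : ∑ S ∈ univ.erase (∅ : Finset (Fin n)),
        (((#S : ℝ) + 1)⁻¹ / 2 + 3 / 2 * (((#S : ℝ) + 1) * ((#S : ℝ) + 2))⁻¹) ≤
      ∑ S : Finset (Fin n),
        (((#S : ℝ) + 1)⁻¹ / 2 + 3 / 2 * (((#S : ℝ) + 1) * ((#S : ℝ) + 2))⁻¹) :=
    sum_le_sum_of_subset_of_nonneg (erase_subset _ _) fun S _ _ => by positivity
  refine hle.trans (hle'.trans ?_)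
  rw [sum_add_distrib, ← sum_div, ← mul_sum, sum_inv_card_add_one]
  have h2 := sum_inv_card_add_one_mul_card_add_two_le n
  have e1 : ((2 : ℝ) ^ (n + 1) - 1) / (n + 1) / 2 ≤ 2 ^ n / (n + 1) := by
    rw [div_right_comm]
    refine div_le_div_of_nonneg_right ?_ (by positivity)
    rw [pow_succ]
    linarith
  have e2 : 6 * 2 ^ n / (((n : ℝ) + 1) * (n + 2)) =
      3 / 2 * (2 ^ (n + 2) / ((n + 1) * (n + 2))) := by
    rw [pow_add]
    ring
  rw [e2]
  linarith

end EnhancedHypercube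

/-! ### Rate of convergence -/

open EnhancedHypercube in
theorem abs_kirchhoffIndex_ratio_sub_one_le {n k : ℕ} (hk : 1 ≤ k) (hkn : k + 1 ≤ n) :
    |kirchhoffIndex (enhancedHypercube n k) / ((2 : ℝ) ^ (2 * n) / ((n : ℝ) + 1)) - 1| ≤
      6 / ((n : ℝ) + 2) := by
  rw [kirchhoffIndex_enhancedHypercube hk hkn]
  have hl := le_sum_inv_laplaceEigenvalue n k
  have hu := sum_inv_laplaceEigenvalue_le n k
  set s := ∑ S ∈ Finset.univ.erase (∅ : Finset (Fin n)), (laplaceEigenvalue k S)⁻¹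
  have hn : (0 : ℝ) < (n : ℝ) + 1 := by positivity
  have hn2 : (0 : ℝ) < (n : ℝ) + 2 := by positivity
  have hp : (0 : ℝ) < 2 ^ n := by positivity
  have hq : 2 ^ n * s / ((2 : ℝ) ^ (2 * n) / ((n : ℝ) + 1)) = s * ((n : ℝ) + 1) / 2 ^ n := by
    rw [two_mul, pow_add]
    field_simp
  -- The lower bound for the ratio falls short of `1` by `(n+2)/(2 * 2^n)`; this makes that at most
  -- `6/(n+2)`.
  have hsq : ((n : ℝ) + 2) ^ 2 ≤ 12 * 2 ^ n := by
    have : (n + 2) ^ 2 ≤ 12 * 2 ^ n := by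
      clear * -
      induction n with
      | zero => norm_num
      | succ n ih =>
        -- The doubling bound `(n+3)^2 ≤ 2(n+2)^2` fails at `n = 0`.
        rcases Nat.lt_or_ge n 1 with h | h
        · interval_cases n
          norm_num
        · have : (n + 1 + 2) ^ 2 ≤ 2 * (n + 2) ^ 2 := by nlinarith
          rw [pow_succ 2 n]
          linarith
    exact_mod_cast this
  rw [hq, abs_le]
  constructor
  · rw [le_sub_iff_add_le, le_div_iff₀ hp]
    have h1 := mul_le_mul_of_nonneg_right hl hn.le
    have e : ((2 ^ (n + 1) - 1) / ((n : ℝ) + 1) - 1) / 2 * ((n : ℝ) + 1) =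
        2 ^ n - ((n : ℝ) + 2) / 2 := by
      rw [pow_succ]
      field_simp
      ring
    have h2 : ((n : ℝ) + 2) / 2 ≤ 6 / ((n : ℝ) + 2) * 2 ^ n := by
      rw [div_mul_eq_mul_div, div_le_div_iff₀ two_pos hn2]
      nlinarith
    linarith
  · rw [sub_le_iff_le_add, div_le_iff₀ hp]
    have h1 := mul_le_mul_of_nonneg_right hu hn.le
    have e : (2 ^ n / ((n : ℝ) + 1) + 6 * 2 ^ n / (((n : ℝ) + 1) * (n + 2))) * ((n : ℝ) + 1) =
        (6 / ((n : ℝ) + 2) + 1) * 2 ^ n := by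
      field_simp
      ring
    linarith

theorem theorem7 :
    ∀ ε : ℝ, 0 < ε → ∃ N : ℕ, ∀ n : ℕ, N ≤ n → ∀ k : ℕ, 1 ≤ k → k + 1 ≤ n →
      |EnhancedHypercube.kirchhoffIndex (EnhancedHypercube.enhancedHypercube n k) /
          ((2 : ℝ) ^ (2 * n) / ((n : ℝ) + 1)) - 1| < ε := by
  intro ε hε
  obtain ⟨N, hN⟩ := exists_nat_gt (6 / ε)
  refine ⟨N, fun n hn k hk hkn => (abs_kirchhoffIndex_ratio_sub_one_le hk hkn).trans_lt ?_⟩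
  have h : (N : ℝ) ≤ n := by exact_mod_cast hn
  rw [div_lt_iff₀ hε] at hN
  rw [div_lt_iff₀ (by positivity)]
  nlinarith
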